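/- Let $K$ be an infinite field, $n\ge 1$, $S=K[x_1,\dots,x_n]$ with the standard grading, and $\mathfrak m=(x_1,\dots,x_n)$. An ideal $J\subseteq S$ is called $\mathfrak m$-full if $(J\mathfrak m:x)=J$ for a generic $x\in\mathfrak m\setminus\mathfrak m^2$, full if $(J:x)=(J:\mathfrak m)$ for a generic $x\in\mathfrak m\setminus\mathfrak m^2$, and weakly $\mathfrak m$-full if $(J\mathfrak m:\mathfrak m)=J$; here "for a generic $x$" means: for all $x\in\mathfrak m\setminus\mathfrak m^2$ whose class lies in some nonempty Zariski open subset of the affine space $\mathfrak m/\mathfrak m^2\cong K^n$. For an ideal $I$ let $\mathfrak d_1(I)$, $\mathfrak d_2(I)$, $\mathfrak d_3(I)$ be the least $\ell\ge 0$ such that $I\mathfrak m^k$ is $\mathfrak m$-full, respectively full, respectively weakly $\mathfrak m$-full, for all $k\ge\ell$. Let $I\subseteq S$ be a monomial ideal. Then $\mathfrak d_1(I),\mathfrak d_2(I),\mathfrak d_3(I)$ exist and $\mathfrak d_2(I)\le\mathfrak d_3(I)=\mathfrak d_1(I)$; if moreover $I\neq 0$, then $$\mathfrak d_1(I)\ \le\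 \Big(\sum_{u\in\mathcal G(I)}\deg u\Big)+1-\mu(I)-\omega(I),$$ where $\mathcal G(I)$ is the minimal monomial generating set of $I$, $\mu(I)=\dim_K(I/\mathfrak m I)$, and $\omega(I)=\max\{j:(I/\mathfrak m I)_j\ne 0\}$. The bound is sharp: if $I=(x_1^{a_1},\dots,x_n^{a_n})$ with all $a_i\ge 1$, then $$\mathfrak d_1(I)=\mathfrak d_3(I)=\Big(\sum_{u\in\mathcal G(I)}\deg u\Big)+1-\mu(I)-\omega(I).$$ -/

import Mathlib

open MvPolynomial

namespace DaoNumbers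

noncomputable section

variable {K : Type*} [Field K] {n : ℕ}

/-- The homogeneous maximal ideal `𝔪 = (x₁, …, xₙ)` of `S = K[x₁, …, xₙ]`. -/
abbrev maxIdeal (K : Type*) [Field K] (n : ℕ) : Ideal (MvPolynomial (Fin n) K) :=
  MvPolynomial.idealOfVars (Fin n) K

/-- The class of `x` in `𝔪 / 𝔪² ≅ Kⁿ`, for `x ∈ 𝔪`: the coefficients of the linear part of `x`. -/
def linearPart (x : MvPolynomial (Fin n) K) : Fin n → K :=
  fun i => x.coeff (Finsupp.single i 1)

/-- `P x` holds for a generic `x ∈ 𝔪 ∖ 𝔪²`: there is a nonempty Zariski open subset of the affine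
space `𝔪 / 𝔪² ≅ Kⁿ` such that `P x` holds for all `x ∈ 𝔪 ∖ 𝔪²` whose class lies in it. Every
nonempty open set contains a nonempty basic open set `{c | F c ≠ 0}`, and over an infinite field
such a set is nonempty exactly if the polynomial `F` is not zero. -/
def HoldsForGeneric (P : MvPolynomial (Fin n) K → Prop) : Prop :=
  ∃ F : MvPolynomial (Fin n) K, F ≠ 0 ∧
    ∀ x : MvPolynomial (Fin n) K, x ∈ maxIdeal K n → x ∉ maxIdeal K n ^ 2 →
      eval (linearPart x) F ≠ 0 → P x

/-- `I` is `𝔪`-full: `(I𝔪 : x) = I` for a generic `x ∈ 𝔪 ∖ 𝔪²`. -/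
def IsMFull (I : Ideal (MvPolynomial (Fin n) K)) : Prop :=
  HoldsForGeneric fun x => (I * maxIdeal K n).colon {x} = I

/-- `I` is full: `(I : x) = (I : 𝔪)` for a generic `x ∈ 𝔪 ∖ 𝔪²`. -/
def IsFull (I : Ideal (MvPolynomial (Fin n) K)) : Prop :=
  HoldsForGeneric fun x => I.colon {x} = I.colon (maxIdeal K n : Set (MvPolynomial (Fin n) K))

/-- `I` is weakly `𝔪`-full: `(I𝔪 : 𝔪) = I`. -/
def IsWeaklyMFull (I : Ideal (MvPolynomial (Fin n) K)) : Prop :=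
  (I * maxIdeal K n).colon (maxIdeal K n : Set (MvPolynomial (Fin n) K)) = I

/-- The Dao number `𝔡₁(I)`. -/
def d₁ (I : Ideal (MvPolynomial (Fin n) K)) : ℕ :=
  sInf {l : ℕ | ∀ k : ℕ, l ≤ k → IsMFull (I * maxIdeal K n ^ k)}

/-- The Dao number `𝔡₂(I)`. -/
def d₂ (I : Ideal (MvPolynomial (Fin n) K)) : ℕ :=
  sInf {l : ℕ | ∀ k : ℕ, l ≤ k → IsFull (I * maxIdeal K n ^ k)}

/-- The Dao number `𝔡₃(I)`. -/
def d₃ (I : Ideal (MvPolynomial (Fin n) K)) : ℕ :=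
  sInf {l : ℕ | ∀ k : ℕ, l ≤ k → IsWeaklyMFull (I * maxIdeal K n ^ k)}

/-- A monomial ideal is an ideal generated by a set of monomials `x^a`. -/
def IsMonomialIdeal (I : Ideal (MvPolynomial (Fin n) K)) : Prop :=
  ∃ A : Set (Fin n →₀ ℕ), I = Ideal.span ((fun a => monomial a (1 : K)) '' A)

/-- There are only finitely many monomials of `I` that are minimal under divisibility. -/
theorem finite_minimal_exponents (I : Ideal (MvPolynomial (Fin n) K)) :
    {a : Fin n →₀ ℕ | Minimal (fun b => monomial b (1 : K) ∈ I) a}.Finite :=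
  WellQuasiOrderedLE.finite_of_isAntichain (setOfPred_minimal_antichain _)

/-- The minimal monomial generating set `𝒢(I)` of a monomial ideal `I`, each monomial `x^a` being
represented by its exponent vector `a`: the monomials of `I` that are minimal under divisibility. -/
def minGens (I : Ideal (MvPolynomial (Fin n) K)) : Finset (Fin n →₀ ℕ) :=
  (finite_minimal_exponents I).toFinset

/-- `μ(I) = dim_K (I / 𝔪I)`. -/
def mu (I : Ideal (MvPolynomial (Fin n) K)) : ℕ :=
  Module.finrank K (I ⧸ (maxIdeal K n • (⊤ : Submodule (MvPolynomial (Fin n) K) I)))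

/-- The final degree `ω(I) = max {j | (I / 𝔪I)_j ≠ 0}` of a nonzero homogeneous ideal `I`. Since
`(I / 𝔪I)_j = I_j / (𝔪I)_j`, this component is nonzero exactly if some form of degree `j` lies
in `I` but not in `𝔪I`. -/
def finalDegree (I : Ideal (MvPolynomial (Fin n) K)) : ℕ :=
  sSup {j : ℕ | ∃ f : MvPolynomial (Fin n) K, f.IsHomogeneous j ∧ f ∈ I ∧ f ∉ maxIdeal K n * I}

/-- The number `(∑_{u ∈ 𝒢(I)} deg u) + 1 - μ(I) - ω(I)`, computed in `ℤ`. -/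
def daoBound (I : Ideal (MvPolynomial (Fin n) K)) : ℤ :=
  (∑ a ∈ minGens I, (a.degree : ℤ)) + 1 - (mu I : ℤ) - (finalDegree I : ℤ)

end

end DaoNumbers

open MvPolynomial

/-! For a monomial ideal I, x^u lies in I𝔪ᵏ iff some generator x^a divides it with |a| + k ≤ |u|.
Everything thus reduces to exponents, and I𝔪ᵏ is weakly 𝔪-full iff no monomial outside it is
multiplied into I𝔪ᵏ⁺¹ by every variable (`SocleFree`).

If this holds at all levels l ≥ k, then I𝔪ᵏ is even 𝔪-full, via any x ∈ 𝔪 whose linear coefficients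
are all nonzero (`colon_singleton_eq_of_socleFree`). Conversely 𝔪-full implies weakly 𝔪-full and
full, so 𝔡₂ ≤ 𝔡₁ = 𝔡₃.

For the bound, an obstruction u at level k yields n distinct generators g_i, where g_i exceeds u
exactly in coordinate i; summing their degrees bounds k (`add_degree_le_sum_of_socle`). For pure
powers, the socle monomial of S/I attains it. -/

namespace DaoNumbers

/-! ### Combinatorics of exponent vectors -/

section Exponents

variable {n : ℕ} {A : Set (Fin n →₀ ℕ)} {k : ℕ} {u v : Fin n →₀ ℕ}

/-- The monomial `x^u` lies in `I𝔪ᵏ`, where `I` is generated by the monomials with exponents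
in `A`. -/
def ShiftMem (A : Set (Fin n →₀ ℕ)) (k : ℕ) (u : Fin n →₀ ℕ) : Prop :=
  ∃ a ∈ A, a ≤ u ∧ a.degree + k ≤ u.degree

theorem ShiftMem.add (h : ShiftMem A k u) (v : Fin n →₀ ℕ) : ShiftMem A (k + v.degree) (u + v) := by
  obtain ⟨a, ha, hau, hd⟩ := h
  refine ⟨a, ha, hau.trans le_self_add, ?_⟩
  rw [map_add]
  omega

theorem ShiftMem.mono {l : ℕ} (h : ShiftMem A k u) (hl : l ≤ k) : ShiftMem A l u := by
  obtain ⟨a, ha, hau, hd⟩ := h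
  exact ⟨a, ha, hau, by omega⟩

/-- No exponent is a socle element of `I𝔪ᵏ`, in the sense that `x^u 𝔪 ⊆ I𝔪ᵏ⁺¹` forces
`x^u ∈ I𝔪ᵏ`. -/
def SocleFree (A : Set (Fin n →₀ ℕ)) (k : ℕ) : Prop :=
  ∀ u : Fin n →₀ ℕ, (∀ i, ShiftMem A (k + 1) (u + Finsupp.single i 1)) → ShiftMem A k u

/-- If `x^u` is killed by powers of all variables, a socle element exists above it. -/
theorem SocleFree.shiftMem_of_forall (hA : ∀ l, k ≤ l → SocleFree A l)
    (hu : ∀ i, ∃ N, ShiftMem A (k + N) (u + Finsupp.single i N)) : ShiftMem A k u := by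
  choose N hN using hu
  by_contra hcon
  -- T is bounded by N, hence finite. At a maximal w every successor has left T, so u + w violates
  -- `SocleFree` at level k + |w|.
  set T : Set (Fin n →₀ ℕ) := {w | ¬ ShiftMem A (k + w.degree) (u + w)} with hT
  have hfin : T.Finite := by
    refine (Set.finite_Iic (Finsupp.equivFunOnFinite.symm N)).subset fun w hw i => ?_
    by_contra hi
    refine hw ?_
    have hle : Finsupp.single i (N i) ≤ w := by
      rw [Finsupp.single_le_iff]
      simpa using (not_le.mp hi).le
    obtain ⟨v, rfl⟩ := exists_add_of_le hle
    have := (hN i).add v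
    rwa [add_assoc, add_assoc u, show N i + v.degree = (Finsupp.single i (N i) + v).degree by
      rw [map_add, Finsupp.degree_single]] at this
  obtain ⟨w, hw⟩ := hfin.exists_maximal ⟨0, by simpa [hT] using hcon⟩
  refine hw.prop (hA _ (by omega) _ fun i => ?_)
  by_contra hi
  have hmem : w + Finsupp.single i 1 ∈ T := by
    simpa [hT, ← add_assoc] using hi
  have := hw.le_of_ge hmem le_self_add i
  simp at this

/-- A socle exponent forces a large sum of degrees: its successors are hit by pairwise distinct
generators. -/
theorem add_degree_le_sum_of_socle {G : Finset (Fin n →₀ ℕ)} (hn : 1 ≤ n) (h0 : 0 ∉ G)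
    (hs : ∀ i, ShiftMem (G : Set (Fin n →₀ ℕ)) (k + 1) (u + Finsupp.single i 1))
    (hu : ¬ ShiftMem (G : Set (Fin n →₀ ℕ)) k u) {h : Fin n →₀ ℕ} (hh : h ∈ G) :
    (k : ℤ) + h.degree ≤ ∑ g ∈ G, ((g.degree : ℤ) - 1) := by
  classical
  choose g hg hgle hgd using hs
  replace hgd : ∀ i, (g i).degree + k ≤ u.degree := fun i => by
    have := hgd i
    rw [map_add, Finsupp.degree_single] at this
    omega
  have hgle' : ∀ i j, j ≠ i → g i j ≤ u j := fun i j hj => by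
    simpa [Finsupp.single_apply, hj.symm] using hgle i j
  -- Otherwise g i ≤ u, and g i would witness membership of u at level k.
  have hgi : ∀ i, u i + 1 ≤ g i i := fun i => by
    by_contra hlt
    refine hu ⟨g i, hg i, fun j => ?_, hgd i⟩
    by_cases hj : j = i
    · subst hj
      omega
    · exact hgle' i j hj
  have hinj : Function.Injective g := fun i j hij => by
    by_contra hne
    have h1 := hgi i
    have h2 := hgle' j i hne
    rw [hij] at h1
    omega
  have hpos : ∀ a ∈ G, (0 : ℤ) ≤ (a.degree : ℤ) - 1 := fun a ha => by
    have : a.degree ≠ 0 := fun h => h0 ((Finsupp.degree_eq_zero_iff a).mp h ▸ ha)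
    omega
  have hsub : Finset.univ.image g ⊆ G := by
    simpa [Finset.image_subset_iff] using hg
  have hsum : (u.degree : ℤ) ≤ ∑ a ∈ Finset.univ.image g, ((a.degree : ℤ) - 1) := by
    rw [Finset.sum_image hinj.injOn, Finsupp.degree_eq_sum]
    push_cast
    refine Finset.sum_le_sum fun i _ => ?_
    have := (hgi i).trans (Finsupp.le_degree i (g i))
    omega
  -- If h is not among the g i, its term |h| - 1 joins the sum; the missing 1 comes from k + 1 ≤ k +
  -- |g 0| ≤ |u|.
  by_cases hm : h ∈ Finset.univ.image g
  · obtain ⟨i, -, rfl⟩ := Finset.mem_image.mp hm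
    have := hgd i
    have := Finset.sum_le_sum_of_subset_of_nonneg hsub fun a ha _ => hpos a ha
    omega
  · have h1 := Finset.sum_le_sum_of_subset_of_nonneg (Finset.insert_subset hh hsub)
      fun a ha _ => hpos a ha
    rw [Finset.sum_insert hm] at h1
    have h2 := hgd ⟨0, hn⟩
    have h3 := hpos _ (hg ⟨0, hn⟩)
    omega

end Exponents

/-! ### From exponents to ideals and generic elements -/

section Ideals

variable {K : Type*} [Field K] {n : ℕ} {A : Set (Fin n →₀ ℕ)} {k : ℕ}

open scoped Pointwise in
theorem mem_span_mul_pow_maxIdeal {f : MvPolynomial (Fin n) K} :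
    f ∈ Ideal.span ((fun a => monomial a (1 : K)) '' A) * maxIdeal K n ^ k ↔
      ∀ u ∈ f.support, ShiftMem A k u := by
  have hset : ((fun a => monomial a (1 : K)) '' A) *
      ((fun a : Fin n →₀ ℕ => monomial a (1 : K)) '' (Finsupp.degree ⁻¹' {k})) =
      (fun a => monomial a (1 : K)) '' {c | ∃ a ∈ A, ∃ b : Fin n →₀ ℕ, b.degree = k ∧ a + b = c} := by
    ext p
    simp only [Set.mem_mul, Set.mem_image, exists_exists_and_eq_and, monomial_mul, mul_one,
      Set.mem_preimage, Set.mem_singleton_iff, Set.mem_ofPred_eq]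
    aesop
  rw [pow_idealOfVars_eq_span, Ideal.span_mul_span', hset, mem_ideal_span_monomial_image]
  refine forall₂_congr fun u _ => ⟨?_, ?_⟩
  · rintro ⟨_, ⟨a, ha, b, rfl, rfl⟩, hle⟩
    refine ⟨a, ha, le_self_add.trans hle, ?_⟩
    rw [← map_add]
    exact Finsupp.degree_mono hle
  · rintro ⟨a, ha, hle, hd⟩
    obtain ⟨v, rfl⟩ := exists_add_of_le hle
    rw [map_add] at hd
    obtain ⟨b, hb, hbk⟩ := Finsupp.exists_le_degree_eq v k (by omega)
    exact ⟨a + b, ⟨a, ha, b, hbk, rfl⟩, by gcongr⟩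

theorem monomial_mem_span_mul_pow_maxIdeal {u : Fin n →₀ ℕ} :
    monomial u (1 : K) ∈ Ideal.span ((fun a => monomial a (1 : K)) '' A) * maxIdeal K n ^ k ↔
      ShiftMem A k u := by
  classical
  rw [mem_span_mul_pow_maxIdeal]
  simp [support_monomial]

theorem isWeaklyMFull_span_mul_pow_iff :
    IsWeaklyMFull (Ideal.span ((fun a => monomial a (1 : K)) '' A) * maxIdeal K n ^ k) ↔
      SocleFree A k := by
  rw [IsWeaklyMFull, mul_assoc, ← pow_succ]
  constructor
  · intro h u hu
    rw [← monomial_mem_span_mul_pow_maxIdeal (K := K), ← h, Submodule.colon_span,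
      Submodule.mem_colon]
    rintro _ ⟨i, rfl⟩
    have : monomial u (1 : K) • X i = monomial (u + Finsupp.single i 1) (1 : K) := by
      simp [X, monomial_mul]
    rw [this, monomial_mem_span_mul_pow_maxIdeal]
    exact hu i
  · intro h
    refine le_antisymm (fun f hf => ?_) fun f hf => ?_
    · rw [mem_span_mul_pow_maxIdeal]
      intro u hu
      refine h u fun i => ?_
      have := Submodule.mem_colon.mp hf (X i) (Ideal.subset_span ⟨i, rfl⟩)
      rw [smul_eq_mul, mem_span_mul_pow_maxIdeal] at this
      refine this _ ?_
      rw [mem_support_iff, coeff_mul_X]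
      exact mem_support_iff.mp hu
    · refine Submodule.mem_colon.mpr fun y hy => ?_
      rw [pow_succ, ← mul_assoc]
      exact Ideal.mul_mem_mul hf hy

/-- The generic form of weak `𝔪`-fullness: it suffices that all coefficients of the linear part
of `x` are nonzero. -/
theorem colon_singleton_eq_of_socleFree (hA : ∀ l, k ≤ l → SocleFree A l)
    {x : MvPolynomial (Fin n) K} (hx : x ∈ maxIdeal K n) (hlin : ∀ i, linearPart x i ≠ 0) :
    (Ideal.span ((fun a => monomial a (1 : K)) '' A) * maxIdeal K n ^ k * maxIdeal K n).colon {x} =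
      Ideal.span ((fun a => monomial a (1 : K)) '' A) * maxIdeal K n ^ k := by
  classical
  refine le_antisymm (fun f hf => ?_) fun f hf =>
    Submodule.mem_colon_singleton.mpr (Ideal.mul_mem_mul hf hx)
  rw [Submodule.mem_colon_singleton, smul_eq_mul, mul_assoc, ← pow_succ,
    mem_span_mul_pow_maxIdeal] at hf
  rw [mem_span_mul_pow_maxIdeal]
  by_contra! hcon
  obtain ⟨u₀, hu₀, hu₀'⟩ := hcon
  -- Choose a bad exponent of least degree, then a direction i in which no power of x_i repairs it,
  -- then among such exponents one with u i maximal. The claim is that u + e_i survives in f * x.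
  set B := f.support.filter fun u => ¬ ShiftMem A k u with hB
  obtain ⟨u₁, hu₁, hmin⟩ := B.exists_min_image Finsupp.degree
    ⟨u₀, Finset.mem_filter.mpr ⟨hu₀, hu₀'⟩⟩
  refine (Finset.mem_filter.mp hu₁).2 (SocleFree.shiftMem_of_forall hA fun i => ?_)
  by_contra! hbad
  set C := B.filter fun u => u.degree = u₁.degree ∧
    ∀ N, ¬ ShiftMem A (k + N) (u + Finsupp.single i N) with hC
  obtain ⟨u, hu, hmax⟩ := C.exists_max_image (fun u => u i)
    ⟨u₁, Finset.mem_filter.mpr ⟨hu₁, rfl, hbad⟩⟩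
  obtain ⟨huB, hdeg, hubad⟩ := Finset.mem_filter.mp hu
  obtain ⟨huf, -⟩ := Finset.mem_filter.mp huB
  refine hubad 1 (hf _ ?_)
  rw [mem_support_iff, coeff_mul, Finset.sum_eq_single (u, Finsupp.single i 1)]
  · exact mul_ne_zero (mem_support_iff.mp huf) (hlin i)
  · rintro ⟨w, w'⟩ hw hne
    rw [Finset.HasAntidiagonal.mem_antidiagonal] at hw
    dsimp only at hw ⊢
    by_contra h0
    obtain ⟨hwf, hwx⟩ := mul_ne_zero_iff.mp h0
    have hw'1 : 1 ≤ w'.degree :=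
      (mem_pow_idealOfVars_iff 1 x).mp (by rwa [pow_one]) w' (mem_support_iff.mpr hwx)
    -- A good w would make w + w' = u + e_i good at level k + 1. A bad w has degree at least |u|,
    -- forcing w' = e_j.
    by_cases hwk : ShiftMem A k w
    · refine hubad 1 ((hwk.add w').mono ?_ |> fun h => hw ▸ h)
      omega
    have hwB : w ∈ B := Finset.mem_filter.mpr ⟨mem_support_iff.mpr hwf, hwk⟩
    have hdw := hmin w hwB
    have hdsum := congrArg Finsupp.degree hw
    rw [map_add, map_add, Finsupp.degree_single] at hdsum
    have hw'd : w'.degree = 1 := by omega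
    obtain ⟨j, rfl⟩ : w' ∈ Set.range fun j : Fin n => Finsupp.single j 1 := by
      rw [Finsupp.range_single_one]
      exact hw'd
    dsimp only at *
    by_cases hji : j = i
    · subst hji
      exact hne (by rw [add_right_cancel hw])
    have hwi : w i = u i + 1 := by
      simpa [Finsupp.single_apply, hji] using DFunLike.congr_fun hw i
    have hwC : w ∉ C := fun h => by
      have := hmax w h
      omega
    have : ∃ N, ShiftMem A (k + N) (w + Finsupp.single i N) := by
      by_contra! hN
      exact hwC (Finset.mem_filter.mpr ⟨hwB, by omega, hN⟩)
    obtain ⟨N, hN⟩ := this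
    -- Maximality of u i gives N repairing w in direction i; since w + e_j = u + e_i, N + 1 then
    -- repairs u.
    refine hubad (N + 1) ?_
    have h := hN.add (Finsupp.single j 1)
    rw [Finsupp.degree_single, add_right_comm w, hw] at h
    rwa [add_comm N 1, Finsupp.single_add, ← add_assoc, ← add_assoc, add_right_comm k]
  · intro h
    exact absurd (by rw [Finset.HasAntidiagonal.mem_antidiagonal]) h

theorem isMFull_of_socleFree (hA : ∀ l, k ≤ l → SocleFree A l) :
    IsMFull (Ideal.span ((fun a => monomial a (1 : K)) '' A) * maxIdeal K n ^ k) := by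
  refine ⟨∏ i, X i, Finset.prod_ne_zero_iff.mpr fun i _ => X_ne_zero i, fun x hx _ hF => ?_⟩
  refine colon_singleton_eq_of_socleFree hA hx fun i => ?_
  rw [map_prod, Finset.prod_ne_zero_iff] at hF
  simpa using hF i (Finset.mem_univ i)

theorem HoldsForGeneric.exists [Infinite K] (hn : 1 ≤ n) {P : MvPolynomial (Fin n) K → Prop}
    (h : HoldsForGeneric P) : ∃ x ∈ maxIdeal K n, P x := by
  classical
  obtain ⟨F, hF, hP⟩ := h
  -- The extra factor makes a coordinate of c nonzero, so that x ∉ 𝔪².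
  obtain ⟨c, hc⟩ : ∃ c, eval c (F * X ⟨0, hn⟩) ≠ 0 := by
    by_contra! hc
    exact mul_ne_zero hF (X_ne_zero _) (MvPolynomial.funext fun c => by rw [hc, map_zero])
  rw [map_mul, eval_X] at hc
  set x : MvPolynomial (Fin n) K := ∑ i, C (c i) * X i with hx
  have hlin : linearPart x = c := by
    funext i
    simp [linearPart, hx, coeff_sum, coeff_C_mul, coeff_X, Finsupp.single_left_inj]
  have hxm : x ∈ maxIdeal K n :=
    Ideal.sum_mem _ fun i _ => Ideal.mul_mem_left _ _ (Ideal.subset_span ⟨i, rfl⟩)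
  refine ⟨x, hxm, hP x hxm (fun h2 => ?_) (hlin.symm ▸ left_ne_zero_of_mul hc)⟩
  have := (mem_pow_idealOfVars_iff' 2 x).mp h2 (Finsupp.single ⟨0, hn⟩ 1) (by simp)
  exact right_ne_zero_of_mul hc (by rw [← hlin]; exact this)

theorem IsMFull.isWeaklyMFull [Infinite K] (hn : 1 ≤ n) {J : Ideal (MvPolynomial (Fin n) K)}
    (h : IsMFull J) : IsWeaklyMFull J := by
  obtain ⟨x, hx, hJ⟩ := h.exists hn
  refine le_antisymm (fun f hf => ?_) fun f hf =>
    Submodule.mem_colon.mpr fun y hy => Ideal.mul_mem_mul hf hy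
  rw [← hJ]
  exact Submodule.mem_colon_singleton.mpr (Submodule.mem_colon.mp hf x hx)

/-- If fx ∈ J and y ∈ 𝔪, then (fy)x ∈ J𝔪, so fy ∈ (J𝔪 : x) = J. -/
theorem IsMFull.isFull {J : Ideal (MvPolynomial (Fin n) K)} (h : IsMFull J) : IsFull J := by
  obtain ⟨F, hF, hJ⟩ := h
  refine ⟨F, hF, fun x hx hx2 hxF => le_antisymm (fun f hf => ?_) fun f hf =>
    Submodule.mem_colon_singleton.mpr (Submodule.mem_colon.mp hf x hx)⟩
  refine Submodule.mem_colon.mpr fun y hy => ?_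
  rw [← hJ x hx hx2 hxF, Submodule.mem_colon_singleton, smul_eq_mul, smul_eq_mul, mul_right_comm]
  exact Ideal.mul_mem_mul (Submodule.mem_colon_singleton.mp hf) hy

theorem forall_isMFull_iff [Infinite K] (hn : 1 ≤ n) :
    (∀ l, k ≤ l → IsMFull (Ideal.span ((fun a => monomial a (1 : K)) '' A) * maxIdeal K n ^ l)) ↔
      ∀ l, k ≤ l → SocleFree A l :=
  ⟨fun h l hl => isWeaklyMFull_span_mul_pow_iff.mp ((h l hl).isWeaklyMFull hn),
    fun h _ hl => isMFull_of_socleFree fun l' hl' => h l' (hl.trans hl')⟩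

theorem forall_isWeaklyMFull_iff :
    (∀ l, k ≤ l →
      IsWeaklyMFull (Ideal.span ((fun a => monomial a (1 : K)) '' A) * maxIdeal K n ^ l)) ↔
      ∀ l, k ≤ l → SocleFree A l :=
  forall₂_congr fun _ _ => isWeaklyMFull_span_mul_pow_iff

end Ideals

/-! ### Minimal generators, the bound and the Dao numbers -/

section Generators

variable {K : Type*} [Field K] {n : ℕ} {A : Set (Fin n →₀ ℕ)}
  {I : Ideal (MvPolynomial (Fin n) K)}

theorem mem_minGens {a : Fin n →₀ ℕ} :
    a ∈ minGens I ↔ Minimal (fun b => monomial b (1 : K) ∈ I) a := by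
  simp [minGens]

theorem eq_of_le_of_mem_minGens {a b : Fin n →₀ ℕ} (ha : a ∈ minGens I) (hb : b ∈ minGens I)
    (h : a ≤ b) : a = b :=
  h.antisymm ((mem_minGens.mp hb).le_of_le (mem_minGens.mp ha).prop h)

theorem monomial_mem_span_monomial {u : Fin n →₀ ℕ} :
    monomial u (1 : K) ∈ Ideal.span ((fun a => monomial a (1 : K)) '' A) ↔ ∃ a ∈ A, a ≤ u := by
  classical
  rw [mem_ideal_span_monomial_image]
  simp [support_monomial]

theorem IsMonomialIdeal.eq_span_minGens (hI : IsMonomialIdeal I) :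
    I = Ideal.span ((fun a => monomial a (1 : K)) '' (minGens I : Set (Fin n →₀ ℕ))) := by
  refine le_antisymm ?_ (Ideal.span_le.mpr ?_)
  · obtain ⟨A, hA⟩ := hI
    conv_lhs => rw [hA]
    refine Ideal.span_le.mpr ?_
    rintro _ ⟨a, ha, rfl⟩
    obtain ⟨b, hba, hb⟩ := exists_minimal_le_of_wellFoundedLT
      (fun b => monomial b (1 : K) ∈ I) a (hA ▸ Ideal.subset_span ⟨a, ha, rfl⟩)
    exact monomial_mem_span_monomial.mpr ⟨b, mem_minGens.mpr hb, hba⟩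
  · rintro _ ⟨a, ha, rfl⟩
    exact (mem_minGens.mp ha).prop

theorem IsMonomialIdeal.mem_iff (hI : IsMonomialIdeal I) {f : MvPolynomial (Fin n) K} :
    f ∈ I ↔ ∀ u ∈ f.support, ∃ g ∈ minGens I, g ≤ u := by
  conv_lhs => rw [hI.eq_span_minGens]
  exact mem_ideal_span_monomial_image

theorem degree_lt_degree_of_le_of_ne {a b : Fin n →₀ ℕ} (h : a ≤ b) (hne : a ≠ b) :
    a.degree < b.degree := by
  obtain ⟨c, rfl⟩ := exists_add_of_le h
  have : c.degree ≠ 0 := fun hc => hne (by simp [(Finsupp.degree_eq_zero_iff c).mp hc])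
  rw [map_add]
  omega

/-- An element of `I` lies in `𝔪I` exactly if no minimal generator occurs in it. -/
theorem IsMonomialIdeal.mem_maxIdeal_mul_iff (hI : IsMonomialIdeal I)
    {f : MvPolynomial (Fin n) K} (hf : f ∈ I) :
    f ∈ maxIdeal K n * I ↔ ∀ g ∈ minGens I, f.coeff g = 0 := by
  have : f ∈ maxIdeal K n * I ↔ ∀ u ∈ f.support, ShiftMem (minGens I : Set (Fin n →₀ ℕ)) 1 u := by
    conv_lhs => rw [hI.eq_span_minGens, mul_comm, ← pow_one (maxIdeal K n)]
    exact mem_span_mul_pow_maxIdeal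
  rw [this]
  constructor
  · intro h g hg
    by_contra hc
    obtain ⟨a, ha, hag, hd⟩ := h g (mem_support_iff.mpr hc)
    rw [eq_of_le_of_mem_minGens ha hg hag] at hd
    omega
  · intro h u hu
    obtain ⟨g, hg, hgu⟩ := hI.mem_iff.mp hf u hu
    refine ⟨g, hg, hgu, degree_lt_degree_of_le_of_ne hgu ?_⟩
    rintro rfl
    exact mem_support_iff.mp hu (h g hg)

/-- Reading off the coefficients at the minimal generators maps I onto a coordinate space with
kernel 𝔪I. -/
theorem IsMonomialIdeal.mu_eq_card (hI : IsMonomialIdeal I) : mu I = (minGens I).card := by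
  classical
  let φ : I →ₗ[K] (minGens I → K) :=
    { toFun := fun f g => (f : MvPolynomial (Fin n) K).coeff g
      map_add' := fun f g => by ext; simp
      map_smul' := fun c f => by ext; simp }
  have hker : LinearMap.ker φ =
      (maxIdeal K n • (⊤ : Submodule (MvPolynomial (Fin n) K) I)).restrictScalars K := by
    ext f
    rw [Submodule.restrictScalars_mem, Submodule.mem_smul_top_iff, smul_eq_mul,
      hI.mem_maxIdeal_mul_iff f.2, LinearMap.mem_ker, funext_iff]
    simp [φ]
  have hsurj : Function.Surjective φ := fun c => by
    refine ⟨⟨∑ g : minGens I, C (c g) * monomial g.1 (1 : K), Ideal.sum_mem _ fun g _ =>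
      Ideal.mul_mem_left _ _ (mem_minGens.mp g.2).prop⟩, ?_⟩
    ext g
    simp [φ, coeff_sum, coeff_C_mul, coeff_monomial]
  have e := (Submodule.Quotient.restrictScalarsEquiv K
      (maxIdeal K n • (⊤ : Submodule (MvPolynomial (Fin n) K) I))).symm.trans
    ((Submodule.quotEquivOfEq _ _ hker.symm).trans (φ.quotKerEquivOfSurjective hsurj))
  rw [mu, e.finrank_eq, Module.finrank_fintype_fun_eq_card, Fintype.card_coe]

theorem IsMonomialIdeal.minGens_nonempty (hI : IsMonomialIdeal I) (h0 : I ≠ ⊥) :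
    (minGens I).Nonempty := by
  rw [Finset.nonempty_iff_ne_empty]
  intro h
  refine h0 ?_
  rw [hI.eq_span_minGens, h]
  simp

theorem IsMonomialIdeal.exists_finalDegree_eq (hI : IsMonomialIdeal I) (h0 : I ≠ ⊥) :
    ∃ h ∈ minGens I, (∀ g ∈ minGens I, g.degree ≤ h.degree) ∧ finalDegree I = h.degree := by
  classical
  obtain ⟨h, hh, hmax⟩ := (minGens I).exists_max_image Finsupp.degree (hI.minGens_nonempty h0)
  refine ⟨h, hh, hmax, IsGreatest.csSup_eq ⟨?_, ?_⟩⟩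
  · have hmem := (mem_minGens.mp hh).prop
    refine ⟨monomial h 1, isHomogeneous_monomial _ rfl, hmem, fun hc => ?_⟩
    have := (hI.mem_maxIdeal_mul_iff hmem).mp hc h hh
    simp at this
  · rintro j ⟨f, hfj, hfI, hf⟩
    rw [hI.mem_maxIdeal_mul_iff hfI] at hf
    push Not at hf
    obtain ⟨g, hg, hc⟩ := hf
    have hgj : g.degree = j := by
      rw [Finsupp.degree_eq_weight_one]
      exact hfj hc
    exact hgj ▸ hmax g hg

theorem IsMonomialIdeal.exists_daoBound_eq (hI : IsMonomialIdeal I) (h0 : I ≠ ⊥) :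
    ∃ h ∈ minGens I, (∀ g ∈ minGens I, g.degree ≤ h.degree) ∧
      daoBound I = ∑ g ∈ minGens I, ((g.degree : ℤ) - 1) + 1 - h.degree := by
  obtain ⟨h, hh, hmax, hfd⟩ := hI.exists_finalDegree_eq h0
  refine ⟨h, hh, hmax, ?_⟩
  rw [daoBound, hI.mu_eq_card, hfd, Finset.sum_sub_distrib]
  simp
  ring

theorem one_le_degree_of_zero_notMem (h0 : 0 ∉ minGens I) {g : Fin n →₀ ℕ} (hg : g ∈ minGens I) :
    1 ≤ g.degree := by
  have : g.degree ≠ 0 := fun h => h0 ((Finsupp.degree_eq_zero_iff g).mp h ▸ hg)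
  omega

/-- Lets the integer bound serve as a natural-number level through `Int.toNat`. -/
theorem IsMonomialIdeal.daoBound_nonneg (hI : IsMonomialIdeal I) (h0 : I ≠ ⊥) :
    0 ≤ daoBound I := by
  obtain ⟨h, hh, hmax, hb⟩ := hI.exists_daoBound_eq h0
  rw [hb]
  by_cases hz : 0 ∈ minGens I
  · have hG : minGens I = {0} := Finset.eq_singleton_iff_unique_mem.mpr
      ⟨hz, fun g hg => (eq_of_le_of_mem_minGens hz hg (zero_le)).symm⟩
    rw [hG, Finset.mem_singleton] at hh
    simp [hG, hh]
  · have := Finset.single_le_sum (f := fun g : Fin n →₀ ℕ => (g.degree : ℤ) - 1)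
      (fun g hg => by have := one_le_degree_of_zero_notMem hz hg; omega) hh
    omega

theorem IsMonomialIdeal.socleFree_of_daoBound_le (hn : 1 ≤ n) (hI : IsMonomialIdeal I) (h0 : I ≠ ⊥)
    {k : ℕ} (hk : daoBound I ≤ k) : SocleFree (minGens I : Set (Fin n →₀ ℕ)) k := by
  intro u hs
  -- For the unit ideal only degrees matter: |u| + 1 ≥ k + 1.
  by_cases hz : 0 ∈ minGens I
  · refine ⟨0, hz, zero_le, ?_⟩
    obtain ⟨a, -, -, hd⟩ := hs ⟨0, hn⟩
    rw [map_add, Finsupp.degree_single] at hd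
    rw [map_zero]
    omega
  · by_contra hu
    obtain ⟨h, hh, -, hb⟩ := hI.exists_daoBound_eq h0
    have := add_degree_le_sum_of_socle hn hz hs hu hh
    omega

theorem IsMonomialIdeal.exists_forall_socleFree (hn : 1 ≤ n) (hI : IsMonomialIdeal I) :
    ∃ l, ∀ k, l ≤ k → SocleFree (minGens I : Set (Fin n →₀ ℕ)) k := by
  by_cases h0 : I = ⊥
  · refine ⟨0, fun k _ u hs => ?_⟩
    obtain ⟨a, ha, -⟩ := hs ⟨0, hn⟩
    have := (mem_minGens.mp ha).prop
    rw [h0, Ideal.mem_bot, monomial_eq_zero] at this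
    exact absurd this one_ne_zero
  · exact ⟨(daoBound I).toNat, fun k hk =>
      hI.socleFree_of_daoBound_le hn h0 (Int.toNat_le.mp hk)⟩

theorem IsMonomialIdeal.d₁_eq [Infinite K] (hn : 1 ≤ n) (hI : IsMonomialIdeal I) :
    d₁ I = sInf {l | ∀ k, l ≤ k → SocleFree (minGens I : Set (Fin n →₀ ℕ)) k} := by
  conv_lhs => rw [hI.eq_span_minGens]
  simp only [d₁, forall_isMFull_iff hn]

theorem IsMonomialIdeal.d₃_eq (hI : IsMonomialIdeal I) :
    d₃ I = sInf {l | ∀ k, l ≤ k → SocleFree (minGens I : Set (Fin n →₀ ℕ)) k} := by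
  conv_lhs => rw [hI.eq_span_minGens]
  simp only [d₃, forall_isWeaklyMFull_iff]

theorem IsMonomialIdeal.d₃_eq_d₁ [Infinite K] (hn : 1 ≤ n) (hI : IsMonomialIdeal I) :
    d₃ I = d₁ I := by
  rw [hI.d₁_eq hn, hI.d₃_eq]

theorem IsMonomialIdeal.exists_forall_isMFull [Infinite K] (hn : 1 ≤ n) (hI : IsMonomialIdeal I) :
    ∃ l, ∀ k, l ≤ k → IsMFull (I * maxIdeal K n ^ k) := by
  obtain ⟨l, hl⟩ := hI.exists_forall_socleFree hn
  refine ⟨l, ?_⟩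
  rw [hI.eq_span_minGens]
  exact (forall_isMFull_iff hn).mpr hl

theorem IsMonomialIdeal.d₁_le_daoBound [Infinite K] (hn : 1 ≤ n) (hI : IsMonomialIdeal I)
    (h0 : I ≠ ⊥) : (d₁ I : ℤ) ≤ daoBound I := by
  rw [← Int.le_toNat (hI.daoBound_nonneg h0), hI.d₁_eq hn]
  exact Nat.sInf_le fun k hk => hI.socleFree_of_daoBound_le hn h0 (Int.toNat_le.mp hk)

/-- Existence is needed because `sInf ∅ = 0`: it ensures that `d₁ I` itself belongs to its defining
set. -/
theorem d₂_le_d₁ (h : ∃ l, ∀ k, l ≤ k → IsMFull (I * maxIdeal K n ^ k)) : d₂ I ≤ d₁ I :=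
  Nat.sInf_le fun k hk => (Nat.sInf_mem h k hk).isFull

end Generators

/-! ### Sharpness for pure powers -/

section PurePowers

variable (K : Type*) [Field K] {n : ℕ} (a : Fin n → ℕ)

theorem span_X_pow_eq_span_monomial :
    Ideal.span (Set.range fun i : Fin n => (X i : MvPolynomial (Fin n) K) ^ a i) =
      Ideal.span ((fun b => monomial b (1 : K)) '' Set.range fun i => Finsupp.single i (a i)) := by
  congr 1
  rw [← Set.range_comp]
  simp [Function.comp_def, X_pow_eq_monomial]

theorem isMonomialIdeal_span_X_pow : IsMonomialIdeal
    (Ideal.span (Set.range fun i : Fin n => (X i : MvPolynomial (Fin n) K) ^ a i)) :=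
  ⟨_, span_X_pow_eq_span_monomial K a⟩

variable {a}

theorem injective_single (ha : ∀ i, 1 ≤ a i) :
    Function.Injective fun i => Finsupp.single i (a i) := fun i _ h =>
  ((Finsupp.single_eq_single_iff _ _ _ _).mp h).elim And.left fun h =>
    absurd h.1 (Nat.one_le_iff_ne_zero.mp (ha i))

theorem minGens_span_X_pow (ha : ∀ i, 1 ≤ a i) :
    minGens (Ideal.span (Set.range fun i : Fin n => (X i : MvPolynomial (Fin n) K) ^ a i)) =
      Finset.univ.image fun i => Finsupp.single i (a i) := by
  have hle : ∀ i j, Finsupp.single i (a i) ≤ Finsupp.single j (a j) → i = j := fun i j h => by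
    by_contra hne
    have := h i
    rw [Finsupp.single_eq_same, Finsupp.single_eq_of_ne hne] at this
    have := ha i
    omega
  ext b
  rw [mem_minGens, span_X_pow_eq_span_monomial]
  simp only [monomial_mem_span_monomial, Set.exists_range_iff, Finset.mem_image, Finset.mem_univ,
    true_and]
  constructor
  · intro hb
    obtain ⟨i, hi⟩ := hb.prop
    exact ⟨i, hi.antisymm (hb.le_of_le ⟨i, le_rfl⟩ hi)⟩
  · rintro ⟨i, rfl⟩
    refine ⟨⟨i, le_rfl⟩, ?_⟩
    rintro c ⟨_, hj⟩ hc
    obtain rfl := hle _ i (hj.trans hc)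
    exact hj

theorem daoBound_span_X_pow_le_d₃ (hn : 1 ≤ n) (ha : ∀ i, 1 ≤ a i) :
    daoBound (Ideal.span (Set.range fun i : Fin n => (X i : MvPolynomial (Fin n) K) ^ a i)) ≤
      d₃ (Ideal.span (Set.range fun i : Fin n => (X i : MvPolynomial (Fin n) K) ^ a i)) := by
  have hI := isMonomialIdeal_span_X_pow K a
  have hG := minGens_span_X_pow K ha
  set I := Ideal.span (Set.range fun i : Fin n => (X i : MvPolynomial (Fin n) K) ^ a i) with hIdef
  have h0 : I ≠ ⊥ := fun h => by
    have : (X ⟨0, hn⟩ : MvPolynomial (Fin n) K) ^ a ⟨0, hn⟩ ∈ I := Ideal.subset_span ⟨_, rfl⟩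
    rw [h, Ideal.mem_bot] at this
    exact pow_ne_zero _ (X_ne_zero _) this
  obtain ⟨h, hh, hmax, hb⟩ := hI.exists_daoBound_eq h0
  have hmem : ∀ i, Finsupp.single i (a i) ∈ minGens I := fun i => by
    rw [hG]
    exact Finset.mem_image.mpr ⟨i, Finset.mem_univ i, rfl⟩
  -- The socle monomial of S/I: it lies outside I, but every x_i x^u lies in I.
  set u : Fin n →₀ ℕ := Finsupp.equivFunOnFinite.symm fun i => a i - 1 with hu
  have hui : ∀ i, u i + 1 = a i := fun i => by
    have := ha i
    change a i - 1 + 1 = a i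
    omega
  have hsum : ∑ g ∈ minGens I, ((g.degree : ℤ) - 1) = u.degree := by
    rw [hG, Finset.sum_image (injective_single ha).injOn, Finsupp.degree_eq_sum]
    push_cast
    refine Finset.sum_congr rfl fun i _ => ?_
    rw [Finsupp.degree_single, ← hui i]
    push_cast
    ring
  rw [hb, hsum]
  by_contra! hlt
  -- With k = |u| - |h|, each u + e_i has degree |h| + k + 1 ≥ a i + k + 1, so u is an obstruction
  -- at a level k ≥ 𝔡₃.
  obtain ⟨k, hk⟩ : ∃ k, u.degree = h.degree + k := ⟨u.degree - h.degree, by omega⟩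
  have hmemd : ∀ l, d₃ I ≤ l → SocleFree (minGens I : Set (Fin n →₀ ℕ)) l := by
    rw [hI.d₃_eq]
    exact Nat.sInf_mem (hI.exists_forall_socleFree hn)
  obtain ⟨g, hg, hgu, -⟩ := hmemd k (by omega) u fun i => by
    refine ⟨_, hmem i, ?_, ?_⟩
    · rw [Finsupp.single_le_iff, Finsupp.add_apply, Finsupp.single_eq_same, hui]
    · have := hmax _ (hmem i)
      rw [map_add, Finsupp.degree_single i 1]
      omega
  rw [Finset.mem_coe, hG, Finset.mem_image] at hg
  obtain ⟨i, -, rfl⟩ := hg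
  have := Finsupp.single_le_iff.mp hgu
  have := hui i
  omega

theorem d₁_span_X_pow_eq_daoBound [Infinite K] (hn : 1 ≤ n) (ha : ∀ i, 1 ≤ a i) :
    (d₁ (Ideal.span (Set.range fun i : Fin n => (X i : MvPolynomial (Fin n) K) ^ a i)) : ℤ) =
      daoBound (Ideal.span (Set.range fun i : Fin n => (X i : MvPolynomial (Fin n) K) ^ a i)) := by
  have hI := isMonomialIdeal_span_X_pow K a
  refine le_antisymm (hI.d₁_le_daoBound hn fun h => ?_)
    (hI.d₃_eq_d₁ hn ▸ daoBound_span_X_pow_le_d₃ K hn ha)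
  have : (X ⟨0, hn⟩ : MvPolynomial (Fin n) K) ^ a ⟨0, hn⟩ ∈
      Ideal.span (Set.range fun i : Fin n => (X i : MvPolynomial (Fin n) K) ^ a i) :=
    Ideal.subset_span ⟨_, rfl⟩
  rw [h, Ideal.mem_bot] at this
  exact pow_ne_zero _ (X_ne_zero _) this

end PurePowers

end DaoNumbers

theorem corollary3p3 {K : Type*} [Field K] [Infinite K] {n : ℕ} (hn : 1 ≤ n) :
    (∀ I : Ideal (MvPolynomial (Fin n) K), DaoNumbers.IsMonomialIdeal I →
      -- the three minima defining the Dao numbers exist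
      (∃ l : ℕ, ∀ k : ℕ, l ≤ k → DaoNumbers.IsMFull (I * DaoNumbers.maxIdeal K n ^ k)) ∧
      (∃ l : ℕ, ∀ k : ℕ, l ≤ k → DaoNumbers.IsFull (I * DaoNumbers.maxIdeal K n ^ k)) ∧
      (∃ l : ℕ, ∀ k : ℕ, l ≤ k → DaoNumbers.IsWeaklyMFull (I * DaoNumbers.maxIdeal K n ^ k)) ∧
      DaoNumbers.d₂ I ≤ DaoNumbers.d₃ I ∧
      DaoNumbers.d₃ I = DaoNumbers.d₁ I ∧
      (I ≠ ⊥ → (DaoNumbers.d₁ I : ℤ) ≤ DaoNumbers.daoBound I)) ∧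
    -- equality for complete intersections of pure powers of all the variables
    (∀ a : Fin n → ℕ, (∀ i, 1 ≤ a i) →
      (DaoNumbers.d₁ (Ideal.span (Set.range fun i : Fin n =>
          (MvPolynomial.X i : MvPolynomial (Fin n) K) ^ a i)) : ℤ) =
        DaoNumbers.daoBound (Ideal.span (Set.range fun i : Fin n =>
          (MvPolynomial.X i : MvPolynomial (Fin n) K) ^ a i)) ∧
      (DaoNumbers.d₃ (Ideal.span (Set.range fun i : Fin n =>
          (MvPolynomial.X i : MvPolynomial (Fin n) K) ^ a i)) : ℤ) =
        DaoNumbers.daoBound (Ideal.span (Set.range fun i : Fin n =>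
          (MvPolynomial.X i : MvPolynomial (Fin n) K) ^ a i))) := by
  refine ⟨fun I hI => ?_, fun a ha => ?_⟩
  · have hM := hI.exists_forall_isMFull hn
    refine ⟨hM, ?_, ?_, ?_, hI.d₃_eq_d₁ hn, hI.d₁_le_daoBound hn⟩
    · obtain ⟨l, hl⟩ := hM
      exact ⟨l, fun k hk => (hl k hk).isFull⟩
    · obtain ⟨l, hl⟩ := hM
      exact ⟨l, fun k hk => (hl k hk).isWeaklyMFull hn⟩
    · rw [hI.d₃_eq_d₁ hn]
      exact DaoNumbers.d₂_le_d₁ hM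
  · have h := DaoNumbers.d₁_span_X_pow_eq_daoBound K hn ha
    exact ⟨h, (DaoNumbers.isMonomialIdeal_span_X_pow K a).d₃_eq_d₁ hn ▸ h⟩
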